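/- For a set $G$ with two group operations $\cdot$ and $\circ$, call $(G,\cdot,\circ)$ a skew left brace if $a\circ(b\cdot c)=(a\circ b)\cdot a^{-1}\cdot(a\circ c)$ for all $a,b,c\in G$, where $a^{-1}$ is the inverse of $a$ in $(G,\cdot)$; it is symmetric if $(G,\circ,\cdot)$ is also a skew left brace. For a linearly ordered set $I$, a symmetric linear brace system $(G,\{\circ_i\}_{i\in I})$ is a family of group operations on the set $G$ such that $(G,\circ_i,\circ_j)$ is a symmetric skew left brace for all $i<j$ in $I$. Let $r_0=2$ and $r_{k+1}=2r_k+1$ for $k\ge 0$, and let $(F_2,\cdot)$ be the free group of rank $2$. There is a symmetric linear brace system $(F_2,\{\circ_k\}_{k\in\mathbb{N}\cup\{0\}})$ on the underlying set of $F_2$, with $\circ_0=\cdot$, such that for every $k\ge 0$ the group $(F_2,\circ_k)$ is free of rank $r_k$. In particular, the groups $(F_2,\circ_k)$, $k\ge 0$, are pairwise non-isomorphic. -/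

import Mathlib

/-- `IsSkewBrace A M`: the set `G` with additive group `(G, ·)` given by `A` and multiplicative
group `(G, ∘)` given by `M` is a skew left brace, that is
`a ∘ (b · c) = (a ∘ b) · a⁻¹ · (a ∘ c)` for all `a, b, c`, where `a⁻¹` is the inverse of `a`
in `(G, ·)`. -/
def IsSkewBrace {G : Type*} (A M : Group G) : Prop :=
  ∀ a b c : G, M.mul a (A.mul b c) = A.mul (A.mul (M.mul a b) (A.inv a)) (M.mul a c)

/-- A brace system on the set `G` associated with the pair `(V, E)`: a family of group structures
`(G, ∘_v)`, `v ∈ V`, such that `(G, ∘_u, ∘_v)` is a skew left brace for all `(u, v) ∈ E`. -/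
def IsBraceSystem {V G : Type*} (E : Set (V × V)) (op : V → Group G) : Prop :=
  ∀ u v : V, (u, v) ∈ E → IsSkewBrace (op u) (op v)

/-- A brace system is symmetric if its set of edges is closed under reversal. -/
def IsSymmetricBraceSystem {V G : Type*} (E : Set (V × V)) (op : V → Group G) : Prop :=
  IsBraceSystem E op ∧ ∀ u v : V, (u, v) ∈ E ↔ (v, u) ∈ E

/-- The edges `(i, j)`, `i < j`, of a linearly ordered set. -/
def linearEdges (I : Type*) [LinearOrder I] : Set (I × I) :=
  {p | p.1 < p.2}

/-- A linear brace system: a brace system whose edges are the pairs `(i, j)` with `i < j`. -/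
def IsLinearBraceSystem {I G : Type*} [LinearOrder I] (op : I → Group G) : Prop :=
  IsBraceSystem (linearEdges I) op

/-- A symmetric linear brace system: a linear brace system that is a symmetric brace system once
every edge `(i, j)`, `i < j`, is taken together with its reverse `(j, i)`. So `(G, ∘_i, ∘_j)` is a
symmetric skew brace for all `i < j`. -/
def IsSymmetricLinearBraceSystem {I G : Type*} [LinearOrder I] (op : I → Group G) : Prop :=
  IsLinearBraceSystem op ∧
    IsSymmetricBraceSystem (linearEdges I ∪ Prod.swap ⁻¹' linearEdges I) op

/-- The groups given by the group structures `A` on `G` and `B` on `H` are isomorphic. -/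
def GroupsIsomorphic {G H : Type*} (A : Group G) (B : Group H) : Prop :=
  ∃ f : G ≃ H, ∀ a b : G, f (A.mul a b) = B.mul (f a) (f b)

/-- The sequence `r_0 = 2`, `r_{k+1} = 2 r_k + 1`. -/
def rankSeq : ℕ → ℕ
  | 0 => 2
  | k + 1 => 2 * rankSeq k + 1

/-! Let `t` generate the infinite cyclic group, acting on the free group with basis `x_n`, `n ∈ ℤ`,
by `x_n ↦ x_{n+m}`. In the semidirect product `t x_n t⁻¹ = x_{n+m}`, so for `m > 0` it is free on
`t, x_0, …, x_{m-1}`. All these products live on one set, and translations commute; two commuting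
actions of an abelian group give semidirect products forming a skew brace in either order. Taking `m
= r_k - 1` gives rank `r_k`. Of the sequence, only its start at 2 and strict growth matter. -/

open FreeGroup (of freeGroupCongr)
open Multiplicative (ofAdd)

/-- The action of the infinite cyclic group on the free group with basis `ℤ` whose generator
translates the basis by `m`. -/
def translation (m : ℤ) : Multiplicative ℤ →* MulAut (FreeGroup ℤ) where
  toFun z := freeGroupCongr (Equiv.addRight (z.toAdd * m))
  map_one' := by
    ext x
    induction x using FreeGroup.induction_on <;> simp_all
  map_mul' a b := by
    ext x
    induction x using FreeGroup.induction_on <;> simp_all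
    ring_nf

theorem translation_of (m : ℤ) (z : Multiplicative ℤ) (n : ℤ) :
    translation m z (of n) = of (n + z.toAdd * m) := by
  simp [translation]

theorem translation_commute (m n : ℤ) (y z : Multiplicative ℤ) (x : FreeGroup ℤ) :
    translation m y (translation n z x) = translation n z (translation m y x) := by
  induction x using FreeGroup.induction_on <;> simp_all [translation_of]
  ring_nf

/-- For `m ≠ 0`, the semidirect product of the free group with basis `ℤ` by the translation by `m`
is free of rank `m + 1`. -/
def freeGroupEquivSemidirect (m : ℕ) [NeZero m] :
    FreeGroup (Option (Fin m)) ≃* FreeGroup ℤ ⋊[translation m] Multiplicative ℤ :=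
  MonoidHom.toMulEquiv
    (FreeGroup.lift fun o => o.elim (SemidirectProduct.inr (ofAdd 1))
      fun j => SemidirectProduct.inl (of (j : ℤ)))
    (SemidirectProduct.lift
      -- Division with remainder `n = i * m + j` forces `x_n = t ^ i * x_j * t ^ (-i)`.
      (FreeGroup.lift fun n =>
        MulAut.conj (of none ^ (Int.divModEquiv m n).1) (of (some (Int.divModEquiv m n).2)))
      (zpowersHom _ (of none))
      (by
        -- Equivariance: translating by `z * m` adds `z` to the quotient and keeps the remainder.
        intro z
        ext n
        obtain ⟨⟨i, j⟩, rfl⟩ := (Int.divModEquiv m).symm.surjective n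
        have h : (Int.divModEquiv m).symm (i, j) + z.toAdd * m =
            (Int.divModEquiv m).symm (z.toAdd + i, j) := by
          simp [Int.divModEquiv]; ring
        simp only [MonoidHom.comp_apply, MulEquiv.coe_toMonoidHom, translation_of, h,
          FreeGroup.lift_apply_of, Equiv.apply_symm_apply, zpowersHom_apply, zpow_add, map_mul,
          MulAut.mul_apply]))
    (by
      ext o
      rcases o with _ | j
      · simp
      · have h : Int.divModEquiv m (j : ℤ) = (0, j) := by
          rw [← Equiv.eq_symm_apply]; simp [Int.divModEquiv]
        simp [h, -Int.divModEquiv_apply])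
    (by
      apply SemidirectProduct.hom_ext
      · ext1 n
        obtain ⟨⟨i, j⟩, rfl⟩ := (Int.divModEquiv m).symm.surjective n
        have h : (SemidirectProduct.inr (ofAdd 1) :
            FreeGroup ℤ ⋊[translation m] Multiplicative ℤ) ^ i =
            SemidirectProduct.inr (ofAdd i) := by
          rw [← map_zpow, ← ofAdd_zsmul]; simp
        have h' : (Int.divModEquiv m).symm (i, j) = (j : ℤ) + i * m := by
          simp [Int.divModEquiv]; ring
        simp only [MonoidHom.comp_apply, SemidirectProduct.lift_inl, FreeGroup.lift_apply_of,
          Equiv.apply_symm_apply, MonoidHom.id_apply, MulAut.conj_apply]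
        rw [map_mul, map_mul, map_inv, map_zpow, FreeGroup.lift_apply_of, FreeGroup.lift_apply_of,
          Option.elim_none, Option.elim_some, h, h', ← map_inv, ← SemidirectProduct.inl_aut,
          translation_of, toAdd_ofAdd]
      · ext
        all_goals simp)

/-- Transporting two semidirect products by commuting actions of an abelian group, with the same
underlying set, to a set `G` gives a skew brace. -/
theorem isSkewBrace_of_semidirect {G N C : Type*} [Group N] [CommGroup C]
    (φ ψ : C →* MulAut N) (h : ∀ c d x, φ c (ψ d x) = ψ d (φ c x)) (e : G ≃ N × C) :
    IsSkewBrace (e.trans (SemidirectProduct.equivProd (φ := φ)).symm).group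
      (e.trans (SemidirectProduct.equivProd (φ := ψ)).symm).group := by
  intro a b c
  apply e.injective
  change (e (e.symm _)) = e (e.symm _)
  rw [Equiv.apply_symm_apply, Equiv.apply_symm_apply]
  change ((e a).1 * ψ (e a).2 (e (e.symm _)).1, (e a).2 * (e (e.symm _)).2) =
    ((e (e.symm _)).1 * φ (e (e.symm _)).2 (e (e.symm _)).1, (e (e.symm _)).2 * (e (e.symm _)).2)
  simp only [Equiv.apply_symm_apply]
  change ((e a).1 * ψ (e a).2 ((e b).1 * φ (e b).2 (e c).1), (e a).2 * ((e b).2 * (e c).2)) =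
    ((e (e.symm _)).1 * φ (e (e.symm _)).2 (e (e.symm _)).1 *
      φ ((e (e.symm _)).2 * (e (e.symm _)).2) ((e a).1 * ψ (e a).2 (e c).1),
      (e (e.symm _)).2 * (e (e.symm _)).2 * ((e a).2 * (e c).2))
  simp only [Equiv.apply_symm_apply]
  change _ = ((e a).1 * ψ (e a).2 (e b).1 * φ ((e a).2 * (e b).2) (φ (e a).2⁻¹ (e a).1⁻¹) *
      φ ((e a).2 * (e b).2 * (e a).2⁻¹) ((e a).1 * ψ (e a).2 (e c).1),
      (e a).2 * (e b).2 * (e a).2⁻¹ * ((e a).2 * (e c).2))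
  -- Commutativity of `C` leaves only the twist `φ (e b).2` on the last two factors, so `(e a).1⁻¹`
  -- cancels; what remains is that `φ` and `ψ` commute.
  have hc : (e a).2 * (e b).2 * (e a).2⁻¹ = (e b).2 := by rw [mul_comm (e a).2]; simp
  rw [← MulAut.mul_apply, ← map_mul, hc]
  apply Prod.ext
  · simp [h, mul_assoc]
  · simp [mul_left_comm]

theorem groupsIsomorphic_group {G H : Type*} [B : Group H] (e : G ≃ H) :
    GroupsIsomorphic e.group B :=
  ⟨e, fun _ _ => e.apply_symm_apply _⟩

theorem GroupsIsomorphic.symm {G H : Type*} {A : Group G} {B : Group H}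
    (h : GroupsIsomorphic A B) : GroupsIsomorphic B A := by
  obtain ⟨f, hf⟩ := h
  exact ⟨f.symm, fun a b => f.injective (by simp [hf])⟩

theorem GroupsIsomorphic.trans {G H K : Type*} {A : Group G} {B : Group H} {C : Group K}
    (h : GroupsIsomorphic A B) (h' : GroupsIsomorphic B C) : GroupsIsomorphic A C := by
  obtain ⟨f, hf⟩ := h
  obtain ⟨g, hg⟩ := h'
  exact ⟨f.trans g, fun a b => by simp [hf, hg]⟩

theorem MulEquiv.groupsIsomorphic {G H : Type*} [A : Group G] [B : Group H] (e : G ≃* H) :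
    GroupsIsomorphic A B :=
  ⟨e.toEquiv, e.map_mul⟩

/-- The rank of a free group of finite rank is well defined, by counting homomorphisms to a group
of order two. -/
theorem rank_eq_of_groupsIsomorphic {m n : ℕ}
    (h : GroupsIsomorphic (FreeGroup.instGroup : Group (FreeGroup (Fin m)))
      (FreeGroup.instGroup : Group (FreeGroup (Fin n)))) : m = n := by
  obtain ⟨f, hf⟩ := h
  let f' : FreeGroup (Fin m) ≃* FreeGroup (Fin n) := ⟨f, hf⟩
  let g : (Fin m → Multiplicative (ZMod 2)) ≃ (Fin n → Multiplicative (ZMod 2)) :=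
    FreeGroup.lift.trans (f'.monoidHomCongrLeftEquiv.trans FreeGroup.lift.symm)
  have hg := Fintype.card_congr g
  simp only [Fintype.card_fun, Fintype.card_fin, Fintype.card_multiplicative, ZMod.card] at hg
  exact Nat.pow_right_injective le_rfl hg

theorem rankSeq_strictMono : StrictMono rankSeq :=
  strictMono_nat_of_lt_succ fun k => by rw [rankSeq]; omega

theorem two_le_rankSeq (k : ℕ) : 2 ≤ rankSeq k :=
  rankSeq_strictMono.monotone (Nat.zero_le k)

instance (k : ℕ) : NeZero (rankSeq k - 1) :=
  ⟨by have := two_le_rankSeq k; omega⟩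

def finRankSeqEquiv (k : ℕ) : Fin (rankSeq k) ≃ Option (Fin (rankSeq k - 1)) :=
  (finCongr (by have := two_le_rankSeq k; omega)).trans (finSuccEquiv (rankSeq k - 1))

/-- The free group of rank `rankSeq k` as a semidirect product. -/
def freeGroupRankSeqEquiv (k : ℕ) : FreeGroup (Fin (rankSeq k)) ≃*
    FreeGroup ℤ ⋊[translation (rankSeq k - 1 : ℕ)] Multiplicative ℤ :=
  (freeGroupCongr (finRankSeqEquiv k)).trans (freeGroupEquivSemidirect (rankSeq k - 1))

def freeGroupTwoEquiv : FreeGroup (Fin 2) ≃*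
    FreeGroup ℤ ⋊[translation (rankSeq 0 - 1 : ℕ)] Multiplicative ℤ :=
  freeGroupRankSeqEquiv 0

/-- The set underlying the free group of rank two, as the product set underlying all the semidirect
products by translations. -/
def freeGroupEquivProd : FreeGroup (Fin 2) ≃ FreeGroup ℤ × Multiplicative ℤ :=
  freeGroupTwoEquiv.toEquiv.trans SemidirectProduct.equivProd

/-- The semidirect product by the translation by `rankSeq k - 1`, transported to the free group of
rank two. -/
@[reducible]
def rankSeqGroup (k : ℕ) : Group (FreeGroup (Fin 2)) :=
  (freeGroupEquivProd.trans
    (SemidirectProduct.equivProd (φ := translation (rankSeq k - 1 : ℕ))).symm).group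

/-- The identification with the product set is itself the group isomorphism for `k = 0`, so
transport returns the original multiplication on the nose. -/
theorem rankSeqGroup_zero : rankSeqGroup 0 = FreeGroup.instGroup := by
  apply Group.ext
  funext a b
  change freeGroupTwoEquiv.symm
    (freeGroupTwoEquiv a * freeGroupTwoEquiv b) = a * b
  rw [← map_mul, MulEquiv.symm_apply_apply]

theorem rankSeqGroup_isSkewBrace (i j : ℕ) : IsSkewBrace (rankSeqGroup i) (rankSeqGroup j) :=
  isSkewBrace_of_semidirect _ _ (translation_commute _ _) _

theorem rankSeqGroup_free (k : ℕ) : GroupsIsomorphic (rankSeqGroup k)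
    (FreeGroup.instGroup : Group (FreeGroup (Fin (rankSeq k)))) :=
  (groupsIsomorphic_group _).trans (freeGroupRankSeqEquiv k).symm.groupsIsomorphic

theorem corollary7p7 :
    ∃ op : ℕ → Group (FreeGroup (Fin 2)),
      op 0 = FreeGroup.instGroup ∧
      IsSymmetricLinearBraceSystem op ∧
      (∀ k : ℕ, GroupsIsomorphic (op k)
        (FreeGroup.instGroup : Group (FreeGroup (Fin (rankSeq k))))) ∧
      (∀ i j : ℕ, i ≠ j → ¬ GroupsIsomorphic (op i) (op j)) := by
  refine ⟨rankSeqGroup, rankSeqGroup_zero,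
    ⟨fun i j _ => rankSeqGroup_isSkewBrace i j,
      fun i j _ => rankSeqGroup_isSkewBrace i j, fun i j => ?_⟩,
    rankSeqGroup_free, fun i j hij h => hij ?_⟩
  · simp [linearEdges, or_comm]
  · exact rankSeq_strictMono.injective (rank_eq_of_groupsIsomorphic
      ((rankSeqGroup_free i).symm.trans (h.trans (rankSeqGroup_free j))))
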